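/- Let $\mathbb H$ be the quaternions with the Euclidean norm, $\mathbb S=\{q\in\mathbb H:\operatorname{Re}q=0,\ \|q\|=1\}$, $\mathbb C_I=\{x+Iy:x,y\in\mathbb R\}$ for $I\in\mathbb S$, $\Delta=\{q\in\mathbb H:\|q\|>1\}$ and $\Delta_I=\Delta\cap\mathbb C_I$. A function $f:\Delta\to\mathbb H$ is (left) slice regular if it is real differentiable and, for every $I\in\mathbb S$, $\frac12\left(\frac{\partial}{\partial x}+I\frac{\partial}{\partial y}\right)f(x+Iy)=0$ at all points $x+Iy\in\Delta_I$. (Area Theorem) Let $f$ be slice regular on $\Delta$ with $$f(q)=q+\sum_{n=0}^\infty q^{-n}a_n\qquad(q\in\Delta),\quad a_n\in\mathbb H.$$ Assume that for some $I,J\in\mathbb S$ with $J$ orthogonal to $I$ one has $f|_{\Delta_I}=f_1+f_2J$ with $f_1,f_2:\Delta_I\to\mathbb C_I$ such that the functions $f_1(z)$ and $z+f_2(z)$ are univalent (injective) on $\Delta_I$. Let $m$ denote two-dimensional Lebesgue outer measure on the plane $\mathbb C_I$. Then $\sum_{n\ge1}n\|a_n\|^2$ converges and: 1. $$m\Big(\mathbb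 C_I\setminus\big\{\tfrac12(f(z)-If(z)I):z\in\Delta_I\big\}\Big)+m\Big(\mathbb C_I\setminus\big\{z+\tfrac12(f(z)+If(z)I)\bar J:z\in\Delta_I\big\}\Big)=\pi\Big(2-\sum_{n=1}^\infty n\|a_n\|^2\Big);$$ here $\tfrac12(f-IfI)=f_1$ and $\tfrac12(f+IfI)\bar J=f_2$ on $\Delta_I$. 2. $\sum_{n=1}^\infty n\|a_n\|^2\le 2$. 3. $\|a_1\|\le\sqrt2$, with equality if and only if $f(q)=q+a_0+q^{-1}a_1$ on $\Delta$, where both components of $a_1$ have norm one: $\big\|\tfrac12(a_1-Ia_1I)\big\|=\big\|\tfrac12(a_1+Ia_1I)\bar J\big\|=1$. -/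

import Mathlib

open scoped Quaternion

noncomputable section

namespace SliceRegular

/-- The sphere of imaginary units. -/
def imagUnits : Set ℍ[ℝ] := {q | q.re = 0 ∧ ‖q‖ = 1}

/-- The parametrization `x + iy ↦ x + I y` of the plane spanned by `1` and `I`
(isometric when `I` is an imaginary unit). -/
def planeMap (I : ℍ[ℝ]) (z : ℂ) : ℍ[ℝ] := (z.re : ℍ[ℝ]) + I * (z.im : ℍ[ℝ])

/-- The complex plane `ℂ_I = ℝ + I ℝ` inside the quaternions. -/
def plane (I : ℍ[ℝ]) : Set ℍ[ℝ] := Set.range (planeMap I)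

/-- The operator `½ (∂/∂x + I ∂/∂y)` applied to the restriction of `f` to `ℂ_I`,
at the point `x + I y`. -/
def dbar (I : ℍ[ℝ]) (f : ℍ[ℝ] → ℍ[ℝ]) (x y : ℝ) : ℍ[ℝ] :=
  (1 / 2 : ℝ) • (deriv (fun s : ℝ => f (planeMap I ⟨s, y⟩)) x
    + I * deriv (fun t : ℝ => f (planeMap I ⟨x, t⟩)) y)

/-- Left slice regular functions on an open set `U` of quaternions. -/
def IsSliceRegularOn (f : ℍ[ℝ] → ℍ[ℝ]) (U : Set ℍ[ℝ]) : Prop :=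
  IsOpen U ∧ DifferentiableOn ℝ f U ∧
    ∀ I ∈ imagUnits, ∀ x y : ℝ, planeMap I ⟨x, y⟩ ∈ U → dbar I f x y = 0

/-- The exterior of the closed unit ball. -/
def exterior : Set ℍ[ℝ] := {q | 1 < ‖q‖}

/-- The exterior of the closed unit disc in the plane `ℂ_I`. -/
def sliceExterior (I : ℍ[ℝ]) : Set ℍ[ℝ] := exterior ∩ plane I

/-- The two-dimensional Lebesgue outer measure on the plane `ℂ_I`
(evaluated on the part of `A` that lies in this plane). -/
def planeArea (I : ℍ[ℝ]) (A : Set ℍ[ℝ]) : ENNReal :=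
  MeasureTheory.volume (planeMap I ⁻¹' A)

/-- The component `½ (a - I a I)`. -/
def fstPart (I a : ℍ[ℝ]) : ℍ[ℝ] := (1 / 2 : ℝ) • (a - I * a * I)

/-- The component `½ (a + I a I) J̄`. -/
def sndPart (I J a : ℍ[ℝ]) : ℍ[ℝ] := (1 / 2 : ℝ) • (a + I * a * I) * star J

end SliceRegular

end

/-! ### Parseval's identity and square integrals over annuli. -/

namespace AreaTheorem

open MeasureTheory Set Filter Topology ComplexConjugate

/-! The theorem reduces to Gronwall's classical area theorem (`area_theorem`), applied twice.
Projecting the series of `f` to `ℂ_I` and to `ℂ_I J` is linear over `ℂ_I`, so `f₁(z)` and `z +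
f₂(z)` become univalent functions `z + ∑ bₙ z⁻ⁿ`, whose coefficients are the two components of `aₙ`.
The squared norms of these components add up to `‖aₙ‖²`, and so the two area formulas add up to the
claim.

Gronwall's theorem is proved without boundary curves or Green's formula. Let `p(z) = z + P(1/z)` be
univalent on `|z| > 1`. For large `R`, replace `1/z` by `z̄/R²` on `|z| ≤ R`: the two agree on the
circle `|z| = R`, and the resulting map `G` is a contractive perturbation of the identity, hence a
bijection of the plane (`exists_radius_bijective`). As `G = p` on `|z| ≥ R`, the omitted set of `p`
is `G(|z| < R)` minus `p(1 < |z| < R)`. Both areas are integrals of Jacobians, `1 - |∂̄G|²` and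
`|p'|²`, evaluated by Parseval on circles (`lintegral_annulus_norm_sq`). They equal `πR² - π∑
n|bₙ|²R⁻²ⁿ` and `π(R² - 1) + π∑ n|bₙ|²(1 - R⁻²ⁿ)`. In the difference `R` cancels and `π(1 - ∑
n|bₙ|²)` remains. -/

/-- Parseval's identity for a finite trigonometric sum. -/
theorem integral_norm_sq_trigPolynomial (d : ℕ → ℂ) (N : ℕ) :
    ∫ θ in (-Real.pi)..Real.pi,
      ‖∑ k ∈ Finset.range N, d k * Complex.exp (θ * Complex.I) ^ k‖ ^ 2 =
      2 * Real.pi * ∑ k ∈ Finset.range N, ‖d k‖ ^ 2 := by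
  set p : Polynomial ℂ := ∑ k ∈ Finset.range N, Polynomial.monomial k (d k) with hp
  have hcoeff : ∀ i, p.coeff i = if i < N then d i else 0 := by
    intro i
    simp [hp, Polynomial.coeff_monomial]
  have hsum : ∑ i ∈ p.support, ‖p.coeff i‖ ^ 2 = ∑ k ∈ Finset.range N, ‖d k‖ ^ 2 := by
    rw [Finset.sum_subset (s₂ := Finset.range N)]
    · refine Finset.sum_congr rfl fun k hk => ?_
      rw [hcoeff, if_pos (Finset.mem_range.mp hk)]
    · intro i hi
      rw [Polynomial.mem_support_iff, hcoeff] at hi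
      by_contra h
      exact hi (if_neg (by simpa using h))
    · intro i _ hi
      rw [Polynomial.notMem_support_iff.mp hi]
      simp
  have hP := p.sum_sq_norm_coeff_eq_circleAverage
  rw [hsum, Real.circleAverage_eq_integral_add (-Real.pi),
    intervalIntegral.integral_comp_add_right (fun θ => ‖p.eval (circleMap 0 1 θ)‖ ^ 2)] at hP
  have heval : ∀ θ : ℝ, p.eval (circleMap 0 1 θ) =
      ∑ k ∈ Finset.range N, d k * Complex.exp (θ * Complex.I) ^ k := by
    intro θ
    simp [hp, Polynomial.eval_finsetSum, circleMap]
  simp_rw [heval] at hP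
  rw [hP, smul_eq_mul, ← mul_assoc, mul_inv_cancel₀ (by positivity), one_mul]
  congr 1 <;> ring

theorem norm_exp_mul_I_pow (θ : ℝ) (k : ℕ) : ‖Complex.exp (θ * Complex.I) ^ k‖ = 1 := by
  rw [norm_pow, Complex.norm_exp_ofReal_mul_I, one_pow]

/-- Parseval's identity for an absolutely convergent trigonometric series. -/
theorem hasSum_integral_norm_sq_trigSeries {d : ℕ → ℂ} (hd : Summable fun k => ‖d k‖)
    {F : ℝ → ℂ} (hF : ∀ θ : ℝ, HasSum (fun k => d k * Complex.exp (θ * Complex.I) ^ k) (F θ)) :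
    HasSum (fun k => 2 * Real.pi * ‖d k‖ ^ 2) (∫ θ in (-Real.pi)..Real.pi, ‖F θ‖ ^ 2) := by
  have hlim : Tendsto (fun N => ∫ θ in (-Real.pi)..Real.pi,
      ‖∑ k ∈ Finset.range N, d k * Complex.exp (θ * Complex.I) ^ k‖ ^ 2) atTop
      (𝓝 (∫ θ in (-Real.pi)..Real.pi, ‖F θ‖ ^ 2)) := by
    refine intervalIntegral.tendsto_integral_filter_of_dominated_convergence
      (fun _ => (∑' k, ‖d k‖) ^ 2) ?_ ?_ ?_ ?_
    · refine Eventually.of_forall fun N => Continuous.aestronglyMeasurable ?_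
      fun_prop
    · refine Eventually.of_forall fun N => Eventually.of_forall fun θ _ => ?_
      rw [Real.norm_of_nonneg (by positivity)]
      gcongr
      refine (norm_sum_le _ _).trans ?_
      simp_rw [norm_mul, norm_exp_mul_I_pow, mul_one]
      exact hd.sum_le_tsum _ fun _ _ => norm_nonneg _
    · exact intervalIntegrable_const
    · exact Eventually.of_forall fun θ _ => ((hF θ).tendsto_sum_nat.norm.pow 2)
  rw [hasSum_iff_tendsto_nat_of_nonneg fun _ => by positivity]
  simpa only [integral_norm_sq_trigPolynomial, Finset.mul_sum] using hlim

/-- The `ENNReal` form allows the later exchange of the radial integral with the sum over modes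
without any integrability condition. -/
theorem lintegral_norm_sq_trigSeries {d : ℕ → ℂ} (hd : Summable fun k => ‖d k‖)
    {F : ℝ → ℂ} (hF : ∀ θ : ℝ, HasSum (fun k => d k * Complex.exp (θ * Complex.I) ^ k) (F θ)) :
    ∫⁻ θ in Ioo (-Real.pi) Real.pi, ENNReal.ofReal (‖F θ‖ ^ 2) =
      ∑' k, ENNReal.ofReal (2 * Real.pi * ‖d k‖ ^ 2) := by
  have hs := hasSum_integral_norm_sq_trigSeries hd hF
  have hcont : Continuous F := by
    have : F = fun θ : ℝ => ∑' k, d k * Complex.exp (θ * Complex.I) ^ k :=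
      funext fun θ => (hF θ).tsum_eq.symm
    rw [this]
    refine continuous_tsum (fun k => by fun_prop) hd fun k θ => ?_
    rw [norm_mul, norm_exp_mul_I_pow, mul_one]
  rw [← ENNReal.ofReal_tsum_of_nonneg (fun _ => by positivity) hs.summable, hs.tsum_eq,
    intervalIntegral.integral_of_le (by linarith [Real.pi_pos]), integral_Ioc_eq_integral_Ioo,
    ofReal_integral_eq_lintegral_ofReal]
  · have : IntegrableOn (fun θ => ‖F θ‖ ^ 2) (Icc (-Real.pi) Real.pi) :=
      Continuous.integrableOn_Icc (by fun_prop)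
    exact this.mono_set Ioo_subset_Icc_self
  · exact Eventually.of_forall fun _ => by positivity

/-- Radial integral of one mode. The exponent `e = -1` would give a logarithm; requiring `C = 0`
there makes both sides vanish, since division by zero gives `0`. When `a = 0`, the condition `0 ≤ e`
ensures integrability at the origin. -/
theorem lintegral_Ioo_zpow {a b : ℝ} (ha : 0 ≤ a) (hab : a < b) (C : ℝ) (hC : 0 ≤ C) (e : ℤ)
    (he : e = -1 → C = 0) (hae : a = 0 → 0 ≤ e) :
    ∫⁻ ρ in Ioo a b, ENNReal.ofReal (ρ * (2 * Real.pi * (C * (ρ ^ e) ^ 2))) =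
      ENNReal.ofReal (Real.pi * C * (b ^ (2 * e + 2) - a ^ (2 * e + 2)) / (e + 1)) := by
  by_cases he1 : e = -1
  · simp [he he1]
  have hcond : 0 ≤ 2 * e + 1 ∨ 2 * e + 1 ≠ -1 ∧ (0 : ℝ) ∉ uIcc a b := by
    rcases ha.eq_or_lt with h | h
    · left; have := hae h.symm; omega
    · right
      refine ⟨by omega, ?_⟩
      rw [uIcc_of_le hab.le]
      exact fun h' => absurd h'.1 (not_le.mpr h)
  have hcongr : ∀ ρ ∈ Ioo a b, ρ * (2 * Real.pi * (C * (ρ ^ e) ^ 2)) =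
      (2 * Real.pi * C) * ρ ^ (2 * e + 1) := by
    intro ρ hρ
    have : ρ ≠ 0 := (ha.trans_lt hρ.1).ne'
    rw [zpow_add₀ this, mul_comm 2 e, zpow_mul]
    norm_cast
    ring
  rw [setLIntegral_congr_fun measurableSet_Ioo
    (fun ρ hρ => congrArg ENNReal.ofReal (hcongr ρ hρ))]
  rw [← ofReal_integral_eq_lintegral_ofReal]
  · rw [← integral_Ioc_eq_integral_Ioo, ← intervalIntegral.integral_of_le hab.le,
      intervalIntegral.integral_const_mul, integral_zpow hcond]
    congr 1
    have : (e : ℝ) + 1 ≠ 0 := by exact_mod_cast fun h => he1 (by omega)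
    have h2 : (((2 * e + 1 : ℤ) : ℝ) + 1) = 2 * ((e : ℝ) + 1) := by push_cast; ring
    rw [h2, show 2 * e + 1 + 1 = 2 * e + 2 by ring]
    field_simp
  · have := (intervalIntegral.intervalIntegrable_zpow (μ := volume) (a := a) (b := b)
      (n := 2 * e + 1) (by tauto)).const_mul (2 * Real.pi * C)
    rw [intervalIntegrable_iff_integrableOn_Ioc_of_le hab.le] at this
    exact this.mono_set Ioo_subset_Ioc_self
  · refine (ae_restrict_iff' measurableSet_Ioo).mpr (Eventually.of_forall fun ρ hρ => ?_)
    have : 0 < ρ := ha.trans_lt hρ.1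
    simp only [Pi.zero_apply]
    positivity

/-- The open round annulus centred at the origin. -/
def annulus (a b : ℝ) : Set ℂ := {z | a < ‖z‖ ∧ ‖z‖ < b}

theorem isOpen_annulus (a b : ℝ) : IsOpen (annulus a b) :=
  (isOpen_lt continuous_const continuous_norm).inter (isOpen_lt continuous_norm continuous_const)

theorem insert_zero_annulus {R : ℝ} (hR0 : 0 < R) :
    insert 0 (annulus 0 R) = Metric.ball (0 : ℂ) R := by
  ext z
  simp only [annulus, mem_insert_iff, mem_ofPred_eq, mem_ball_zero_iff, norm_pos_iff]
  constructor
  · rintro (rfl | h)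
    · simpa using hR0
    · exact h.2
  · intro h
    by_cases hz : z = 0
    · exact Or.inl hz
    · exact Or.inr ⟨hz, h⟩

/-- The Dirichlet-type integral over an annulus of a function expanded in angular modes whose
radial factors are powers. -/
theorem lintegral_annulus_norm_sq {a b : ℝ} (ha : 0 ≤ a) (hab : a < b) {h : ℂ → ℂ}
    (hc : ContinuousOn h (annulus a b)) (c : ℕ → ℂ) (e : ℕ → ℤ)
    (he : ∀ k, e k = -1 → c k = 0) (hae : a = 0 → ∀ k, 0 ≤ e k)
    (hsum : ∀ z ∈ annulus a b, Summable fun k => ‖c k‖ * ‖z‖ ^ e k)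
    (hh : ∀ z ∈ annulus a b, h z = ∑' k, c k * (‖z‖ ^ e k : ℝ) * (z / ‖z‖) ^ k) :
    ∫⁻ z in annulus a b, ENNReal.ofReal (‖h z‖ ^ 2) =
      ∑' k, ENNReal.ofReal
        (Real.pi * ‖c k‖ ^ 2 * (b ^ (2 * e k + 2) - a ^ (2 * e k + 2)) / (e k + 1)) := by
  have hmeas : MeasurableSet (annulus a b) := (isOpen_annulus a b).measurableSet
  set H : ℂ → ENNReal := (annulus a b).indicator fun z => ENNReal.ofReal (‖h z‖ ^ 2) with hH
  have hHm : Measurable H := by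
    have : ContinuousOn (fun z => ENNReal.ofReal (‖h z‖ ^ 2)) (annulus a b) :=
      ENNReal.continuous_ofReal.comp_continuousOn (hc.norm.pow 2)
    classical
    have := this.measurable_piecewise (g := fun _ => (0 : ENNReal)) continuousOn_const hmeas
    rw [hH]
    convert this using 1
    ext z
    by_cases hz : z ∈ annulus a b <;> simp [hz]
  rw [← lintegral_indicator hmeas, ← Complex.lintegral_comp_polarCoord_symm]
  have hpm : Measurable fun p : ℝ × ℝ =>
      ENNReal.ofReal p.1 • H (Complex.polarCoord.symm p) := by
    have : Measurable fun p : ℝ × ℝ => Complex.polarCoord.symm p := by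
      simp_rw [Complex.polarCoord_symm_apply]
      fun_prop
    exact (by fun_prop : Measurable fun p : ℝ × ℝ => ENNReal.ofReal p.1).smul (hHm.comp this)
  rw [show polarCoord.target = Ioi (0 : ℝ) ×ˢ Ioo (-Real.pi) Real.pi from rfl,
    Measure.volume_eq_prod, setLIntegral_prod _ hpm.aemeasurable.restrict]
  have hpolar : ∀ ρ θ : ℝ, Complex.polarCoord.symm (ρ, θ) =
      ρ * Complex.exp (θ * Complex.I) := by
    intro ρ θ
    rw [Complex.polarCoord_symm_apply, Complex.exp_mul_I]
    simp
  have hinner : ∀ ρ ∈ Ioi (0 : ℝ),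
      ∫⁻ θ in Ioo (-Real.pi) Real.pi,
        ENNReal.ofReal ρ • H (Complex.polarCoord.symm (ρ, θ)) =
      (Ioo a b).indicator (fun ρ => ∑' k, ENNReal.ofReal
        (ρ * (2 * Real.pi * (‖c k‖ ^ 2 * (ρ ^ e k) ^ 2)))) ρ := by
    intro ρ hρ
    have hρ0 : (0 : ℝ) < ρ := hρ
    have hnorm : ∀ θ : ℝ, ‖(ρ : ℂ) * Complex.exp (θ * Complex.I)‖ = ρ := by
      intro θ
      rw [norm_mul, Complex.norm_exp_ofReal_mul_I, mul_one, Complex.norm_real,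
        Real.norm_of_nonneg hρ0.le]
    have hmem : ∀ θ : ℝ, (ρ : ℂ) * Complex.exp (θ * Complex.I) ∈ annulus a b ↔ ρ ∈ Ioo a b := by
      intro θ
      simp only [annulus, mem_ofPred_eq, hnorm, mem_Ioo]
    -- On a circle inside the annulus, `h` is an absolutely convergent trigonometric series in the
    -- angle, so Parseval applies.
    by_cases hρab : ρ ∈ Ioo a b
    · rw [indicator_of_mem hρab]
      have hs : Summable fun k => ‖c k * (ρ ^ e k : ℝ)‖ := by
        have := hsum _ ((hmem 0).mpr hρab)
        rw [hnorm] at this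
        refine this.congr fun k => ?_
        rw [norm_mul, Complex.norm_real, Real.norm_of_nonneg (by positivity)]
      have key := lintegral_norm_sq_trigSeries hs
        (F := fun θ => h (ρ * Complex.exp (θ * Complex.I))) (by
          intro θ
          rw [hh _ ((hmem θ).mpr hρab), hnorm,
            mul_div_cancel_left₀ _ (Complex.ofReal_ne_zero.mpr hρ0.ne')]
          refine Summable.hasSum (Summable.of_norm ?_)
          refine hs.congr fun k => ?_
          rw [norm_mul _ (_ ^ k), norm_exp_mul_I_pow, mul_one])
      simp_rw [smul_eq_mul]
      rw [lintegral_const_mul' _ _ ENNReal.ofReal_ne_top]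
      have hHe : ∀ θ : ℝ, H (Complex.polarCoord.symm (ρ, θ)) =
          ENNReal.ofReal (‖h (ρ * Complex.exp (θ * Complex.I))‖ ^ 2) := by
        intro θ
        rw [hpolar, hH, indicator_of_mem ((hmem θ).mpr hρab)]
      simp_rw [hHe]
      rw [key, ← ENNReal.tsum_mul_left]
      refine tsum_congr fun k => ?_
      rw [← ENNReal.ofReal_mul hρ0.le, norm_mul, Complex.norm_real,
        Real.norm_of_nonneg (by positivity), mul_pow]
    · rw [indicator_of_notMem hρab]
      have hHe : ∀ θ : ℝ, H (Complex.polarCoord.symm (ρ, θ)) = 0 := by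
        intro θ
        rw [hpolar, hH, indicator_of_notMem (fun h' => hρab ((hmem θ).mp h'))]
      simp_rw [hHe]
      simp
  rw [setLIntegral_congr_fun measurableSet_Ioi hinner, setLIntegral_indicator measurableSet_Ioo,
    inter_eq_left.mpr (show Ioo a b ⊆ Ioi 0 from fun ρ hρ => ha.trans_lt hρ.1), lintegral_tsum]
  · refine tsum_congr fun k => ?_
    refine lintegral_Ioo_zpow ha hab _ (by positivity) _ (fun h => by simp [he k h])
      (fun h => hae h k)
  · intro k
    refine Measurable.aemeasurable ?_
    have : Measurable fun ρ : ℝ => ρ ^ e k := by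
      exact measurable_id.pow_const (e k)
    fun_prop

end AreaTheorem

/-! ### Truncated inversion and a global bijection extending the exterior map. -/

namespace AreaTheorem

open MeasureTheory Set Filter Topology ComplexConjugate

/-- The map equal to `z ↦ z⁻¹` for `R ≤ ‖z‖` and to `z ↦ conj z / R ^ 2` for `‖z‖ ≤ R`. -/
noncomputable def truncInv (R : ℝ) (z : ℂ) : ℂ := conj z / ((max ‖z‖ R : ℝ) : ℂ) ^ 2

theorem truncInv_of_le {R : ℝ} {z : ℂ} (h : ‖z‖ ≤ R) : truncInv R z = conj z / (R : ℂ) ^ 2 := by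
  rw [truncInv, max_eq_right h]

theorem truncInv_of_ge {R : ℝ} {z : ℂ} (h : R ≤ ‖z‖) : truncInv R z = z⁻¹ := by
  rw [truncInv, max_eq_left h, Complex.inv_def, Complex.normSq_eq_norm_sq, div_eq_mul_inv]
  push_cast
  rfl

theorem norm_truncInv_le {R : ℝ} (hR : 0 < R) (z : ℂ) : ‖truncInv R z‖ ≤ R⁻¹ := by
  have hm : 0 < max ‖z‖ R := lt_max_of_lt_right hR
  rw [truncInv, norm_div, norm_pow, Complex.norm_real, Real.norm_of_nonneg hm.le,
    RCLike.norm_conj, div_le_iff₀ (by positivity)]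
  calc ‖z‖ ≤ max ‖z‖ R := le_max_left _ _
    _ = R⁻¹ * (R * max ‖z‖ R) := by field_simp
    _ ≤ R⁻¹ * max ‖z‖ R ^ 2 := by
      rw [sq]
      gcongr
      exact le_max_right _ _

theorem norm_truncInv_sub_le {R : ℝ} (hR : 0 < R) (z w : ℂ) :
    ‖truncInv R z - truncInv R w‖ ≤ (R ^ 2)⁻¹ * ‖z - w‖ := by
  wlog hzw : ‖z‖ ≤ ‖w‖ generalizing z w
  · rw [norm_sub_rev, norm_sub_rev z]
    exact this w z (not_le.mp hzw).le
  rcases le_total ‖w‖ R with hw | hw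
  · rw [truncInv_of_le hw, truncInv_of_le (hzw.trans hw), ← sub_div, ← map_sub, norm_div,
      RCLike.norm_conj, norm_pow, Complex.norm_real, Real.norm_of_nonneg hR.le, div_eq_inv_mul]
  have hw0 : 0 < ‖w‖ := hR.trans_le hw
  have hwne : w ≠ 0 := norm_pos_iff.mp hw0
  rcases le_total ‖z‖ R with hz | hz
  · rw [truncInv_of_le hz, truncInv_of_ge hw]
    have hRne : (R : ℂ) ≠ 0 := Complex.ofReal_ne_zero.mpr hR.ne'
    have h1 : conj z / (R : ℂ) ^ 2 - w⁻¹ = (conj z * w - (R : ℂ) ^ 2) / ((R : ℂ) ^ 2 * w) := by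
      field_simp
    -- With `|z| ≤ R ≤ |w|`, this follows from the identity `|w|²|z-w|² - |z̄w-R²|² =
    -- (|w|²-R²)((R²-|z|²) + |z-w|²)`.
    have h2 : ‖conj z * w - (R : ℂ) ^ 2‖ ≤ ‖w‖ * ‖z - w‖ := by
      refine le_of_sq_le_sq ?_ (by positivity)
      have hz2 : z.re ^ 2 + z.im ^ 2 ≤ R ^ 2 := by
        have := pow_le_pow_left₀ (norm_nonneg z) hz 2
        rwa [← Complex.normSq_eq_norm_sq, Complex.normSq_apply, ← sq, ← sq] at this
      have hw2 : R ^ 2 ≤ w.re ^ 2 + w.im ^ 2 := by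
        have := pow_le_pow_left₀ hR.le hw 2
        rwa [← Complex.normSq_eq_norm_sq, Complex.normSq_apply, ← sq, ← sq] at this
      rw [mul_pow, ← Complex.normSq_eq_norm_sq, ← Complex.normSq_eq_norm_sq,
        ← Complex.normSq_eq_norm_sq]
      simp only [Complex.normSq_apply, ← Complex.ofReal_pow, Complex.sub_re, Complex.sub_im,
        Complex.mul_re, Complex.mul_im, Complex.conj_re, Complex.conj_im, Complex.ofReal_re,
        Complex.ofReal_im]
      nlinarith [mul_nonneg (sub_nonneg.mpr hw2) (add_nonneg (sub_nonneg.mpr hz2)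
        (add_nonneg (sq_nonneg (z.re - w.re)) (sq_nonneg (z.im - w.im))))]
    rw [h1, norm_div, norm_mul, norm_pow, Complex.norm_real, Real.norm_of_nonneg hR.le,
      div_le_iff₀ (by positivity)]
    calc _ ≤ ‖w‖ * ‖z - w‖ := h2
      _ = _ := by field_simp
  · have hz0 : 0 < ‖z‖ := hR.trans_le hz
    have hzne : z ≠ 0 := norm_pos_iff.mp hz0
    rw [truncInv_of_ge hz, truncInv_of_ge hw, inv_sub_inv hzne hwne, norm_div, norm_mul,
      norm_sub_rev, div_eq_inv_mul]
    gcongr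
    rw [sq]
    gcongr

/-- A perturbation of the identity by a contraction is bijective. -/
theorem bijective_id_add_of_contraction {u : ℂ → ℂ} {K : ℝ} (hK : K < 1)
    (hu : ∀ z w, ‖u z - u w‖ ≤ K * ‖z - w‖) : Function.Bijective fun z => z + u z := by
  constructor
  · intro z w h
    have h1 : z - w = -(u z - u w) := by
      have : z + u z = w + u w := h
      linear_combination this
    have h2 := hu z w
    rw [← norm_neg, ← h1] at h2
    by_contra hne
    have : 0 < ‖z - w‖ := norm_pos_iff.mpr (sub_ne_zero.mpr hne)
    nlinarith
  · intro y
    have hc : ContractingWith (Real.toNNReal K) fun z => y - u z := by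
      refine ⟨by simpa using hK, LipschitzWith.of_dist_le_mul fun z w => ?_⟩
      rw [dist_eq_norm, dist_eq_norm, sub_sub_sub_cancel_left, norm_sub_rev]
      refine (hu z w).trans ?_
      gcongr
      exact Real.le_coe_toNNReal K
    refine ⟨ContractingWith.fixedPoint _ hc, ?_⟩
    have : y - u _ = _ := hc.fixedPoint_isFixedPt
    simp only
    linear_combination -this

section PowerSeries

variable {b : ℕ → ℂ} (hb : ∀ w : ℂ, ‖w‖ < 1 → Summable fun n => b n * w ^ n)
include hb

/-- For `r < t < 1` the terms `bₙtⁿ` are bounded, so `(n+1)(r/t)ⁿ` dominates up to a constant. -/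
theorem summable_norm_derivSeries {r : ℝ} (hr0 : 0 ≤ r) (hr : r < 1) :
    Summable fun n : ℕ => ((n : ℝ) + 1) * ‖b (n + 1)‖ * r ^ n := by
  obtain ⟨t, hrt, ht⟩ := exists_between hr
  have ht0 : 0 < t := hr0.trans_lt hrt
  have hlim := (hb (t : ℂ) (by rwa [Complex.norm_real, Real.norm_of_nonneg ht0.le])).tendsto_atTop_zero
  obtain ⟨C, hC⟩ := hlim.norm.bddAbove_range
  have hC' : ∀ n, ‖b n‖ * t ^ n ≤ C := fun n => by
    have : ‖b n * (t : ℂ) ^ n‖ ≤ C := hC ⟨n, rfl⟩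
    rwa [norm_mul, norm_pow, Complex.norm_real, Real.norm_of_nonneg ht0.le] at this
  have hq0 : 0 ≤ r / t := by positivity
  have hq : ‖r / t‖ < 1 := by
    rw [Real.norm_of_nonneg hq0, div_lt_one ht0]
    exact hrt
  have hs : Summable fun n : ℕ => ((n : ℝ) + 1) * (r / t) ^ n := by
    have h1 := summable_pow_mul_geometric_of_norm_lt_one 1 hq
    have h2 := summable_geometric_of_norm_lt_one hq
    refine (h1.add h2).congr fun n => ?_
    simp only [pow_one]
    ring
  refine Summable.of_nonneg_of_le (fun n => by positivity) (fun n => ?_) (hs.mul_left (C / t))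
  have h1 : ‖b (n + 1)‖ ≤ C / t ^ (n + 1) := (le_div_iff₀ (by positivity)).mpr (hC' (n + 1))
  calc ((n : ℝ) + 1) * ‖b (n + 1)‖ * r ^ n ≤ ((n : ℝ) + 1) * (C / t ^ (n + 1)) * r ^ n := by
        gcongr
    _ = C / t * (((n : ℝ) + 1) * (r / t) ^ n) := by
        rw [div_pow]
        rw [pow_succ]
        field_simp

theorem hasDerivAt_tsum_powerSeries {w : ℂ} (hw : ‖w‖ < 1) :
    HasDerivAt (fun w => ∑' n, b n * w ^ n) (∑' n : ℕ, ((n : ℂ) + 1) * b (n + 1) * w ^ n) w := by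
  obtain ⟨r, hwr, hr⟩ := exists_between hw
  have hr0 : 0 ≤ r := (norm_nonneg w).trans hwr.le
  have hu : Summable fun n : ℕ => (n : ℝ) * ‖b n‖ * r ^ (n - 1) := by
    rw [← summable_nat_add_iff 1]
    simpa using summable_norm_derivSeries hb hr0 hr
  have hbound : ∀ n : ℕ, ∀ y ∈ Metric.ball (0 : ℂ) r,
      ‖b n * ((n : ℂ) * y ^ (n - 1))‖ ≤ (n : ℝ) * ‖b n‖ * r ^ (n - 1) := by
    intro n y hy
    rw [mem_ball_zero_iff] at hy
    rw [norm_mul, norm_mul, norm_pow, Complex.norm_natCast, ← mul_assoc, mul_comm ‖b n‖]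
    gcongr
  have hwmem : w ∈ Metric.ball (0 : ℂ) r := mem_ball_zero_iff.mpr hwr
  have key := hasDerivAt_tsum_of_isPreconnected (g := fun n w => b n * w ^ n)
    (g' := fun n y => b n * ((n : ℂ) * y ^ (n - 1))) hu Metric.isOpen_ball
    (convex_ball (0 : ℂ) r).isPreconnected (fun n y _ => (hasDerivAt_pow n y).const_mul (b n))
    hbound hwmem (hb w hw) hwmem
  have hs : Summable fun n : ℕ => b n * ((n : ℂ) * w ^ (n - 1)) :=
    Summable.of_norm_bounded hu fun n => hbound n w hwmem
  rw [hs.tsum_eq_zero_add] at key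
  simp only [Nat.cast_zero, zero_mul, mul_zero, zero_add, Nat.add_sub_cancel, Nat.cast_add,
    Nat.cast_one] at key
  have hcomm : ∀ n : ℕ, b (n + 1) * (((n : ℂ) + 1) * w ^ n) = ((n : ℂ) + 1) * b (n + 1) * w ^ n :=
    fun n => by ring
  simpa only [hcomm] using key

theorem continuousOn_tsum_derivSeries :
    ContinuousOn (fun w : ℂ => ∑' n : ℕ, ((n : ℂ) + 1) * b (n + 1) * w ^ n)
      (Metric.ball (0 : ℂ) 1) := by
  have hd : DifferentiableOn ℂ (fun w => ∑' n, b n * w ^ n) (Metric.ball (0 : ℂ) 1) :=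
    fun w hw => (hasDerivAt_tsum_powerSeries hb
      (mem_ball_zero_iff.mp hw)).differentiableAt.differentiableWithinAt
  refine (hd.deriv Metric.isOpen_ball).continuousOn.congr fun w hw => ?_
  exact (hasDerivAt_tsum_powerSeries hb (mem_ball_zero_iff.mp hw)).deriv.symm

/-- For large `R`, the map `z ↦ z + P (truncInv R z)`, where `P` is the sum of the power series
with coefficients `b`, is a small perturbation of the identity. -/
theorem exists_radius_bijective :
    ∃ R : ℝ, 1 < R ∧
      (Function.Bijective fun z => z + ∑' n, b n * truncInv R z ^ n) ∧
      ∀ w : ℂ, ‖w‖ ≤ R⁻¹ → ‖∑' n : ℕ, ((n : ℂ) + 1) * b (n + 1) * w ^ n‖ / R ^ 2 < 1 := by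
  set M : ℝ := ∑' n : ℕ, ((n : ℝ) + 1) * ‖b (n + 1)‖ * (1 / 2) ^ n with hM
  have hMs := summable_norm_derivSeries hb (r := 1 / 2) (by norm_num) (by norm_num)
  have hM0 : 0 ≤ M := tsum_nonneg fun n => by positivity
  -- `M` bounds `|P'|` on `|w| ≤ 1/2`. This choice gives both `R⁻¹ ≤ 1/2`, so that `truncInv R`
  -- takes values in that disc, and the contraction constant `M / R² < 1`.
  set R : ℝ := M + 2 with hR
  have hR2 : 2 ≤ R := by linarith
  have hR0 : 0 < R := by linarith
  have hK : M / R ^ 2 < 1 := by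
    rw [div_lt_one (by positivity)]
    nlinarith
  have hRinv : R⁻¹ ≤ 1 / 2 := by
    rw [one_div]
    gcongr
  have hQ : ∀ w : ℂ, ‖w‖ ≤ R⁻¹ → ‖∑' n : ℕ, ((n : ℂ) + 1) * b (n + 1) * w ^ n‖ ≤ M := by
    intro w hw
    refine tsum_of_norm_bounded hMs.hasSum fun n => ?_
    rw [norm_mul, norm_mul, norm_pow, ← Nat.cast_succ, Complex.norm_natCast, Nat.cast_succ]
    have := hw.trans hRinv
    gcongr
  refine ⟨R, by linarith, ?_, fun w hw => ?_⟩
  · refine bijective_id_add_of_contraction hK fun z w => ?_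
    have hlip := (convex_closedBall (0 : ℂ) R⁻¹).norm_image_sub_le_of_norm_hasDerivWithin_le
      (f := fun w => ∑' n, b n * w ^ n) (C := M)
      (fun x hx => (hasDerivAt_tsum_powerSeries hb (w := x) (by
        have := mem_closedBall_zero_iff.mp hx
        linarith)).hasDerivWithinAt)
      (fun x hx => hQ x (mem_closedBall_zero_iff.mp hx))
      (mem_closedBall_zero_iff.mpr (norm_truncInv_le hR0 w))
      (mem_closedBall_zero_iff.mpr (norm_truncInv_le hR0 z))
    refine hlip.trans ?_
    calc _ ≤ M * ((R ^ 2)⁻¹ * ‖z - w‖) := by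
          gcongr
          exact norm_truncInv_sub_le hR0 z w
      _ = _ := by ring
  · refine lt_of_le_of_lt ?_ hK
    gcongr
    exact hQ w hw

end PowerSeries

end AreaTheorem

/-! ### Areas of images, computed from Jacobians. -/

namespace AreaTheorem

open MeasureTheory Set Filter Topology ComplexConjugate

/-- The real-linear map `v ↦ α v + β conj v` of the complex plane. -/
noncomputable def mulAddConj (α β : ℂ) : ℂ →L[ℝ] ℂ :=
  α • (1 : ℂ →L[ℝ] ℂ) + β • (Complex.conjCLE : ℂ →L[ℝ] ℂ)

theorem mulAddConj_apply (α β v : ℂ) : mulAddConj α β v = α * v + β * conj v := by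
  simp [mulAddConj]

/-- With `α = ∂F` and `β = ∂̄F` this is the Jacobian of `F`. It is used with `β = 0` for the
holomorphic map and with `α = 1` for the extension into the disc. -/
theorem det_mulAddConj (α β : ℂ) : (mulAddConj α β).det = ‖α‖ ^ 2 - ‖β‖ ^ 2 := by
  rw [ContinuousLinearMap.det, ← LinearMap.det_toMatrix Complex.basisOneI, Matrix.det_fin_two,
    ← Complex.normSq_eq_norm_sq, ← Complex.normSq_eq_norm_sq]
  simp [LinearMap.toMatrix_apply, mulAddConj_apply, Complex.normSq_apply]
  ring

section PowerSeries

variable {b : ℕ → ℂ} (hb : ∀ w : ℂ, ‖w‖ < 1 → Summable fun n => b n * w ^ n)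
include hb

theorem hasDerivAt_add_powerSeries_inv {z : ℂ} (hz : 1 < ‖z‖) :
    HasDerivAt (fun z => z + ∑' n, b n * z⁻¹ ^ n)
      (1 - (∑' n : ℕ, ((n : ℂ) + 1) * b (n + 1) * z⁻¹ ^ n) * z⁻¹ ^ 2) z := by
  have hz0 : z ≠ 0 := norm_pos_iff.mp (one_pos.trans hz)
  have hzi : ‖z⁻¹‖ < 1 := by
    rw [norm_inv]
    exact inv_lt_one_of_one_lt₀ hz
  have h1 := (hasDerivAt_tsum_powerSeries hb hzi).comp z (hasDerivAt_inv hz0)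
  have h2 := (hasDerivAt_id z).add h1
  refine (h2.congr_deriv ?_ :)
  rw [inv_pow]
  ring

theorem hasFDerivAt_add_powerSeries_inv {z : ℂ} (hz : 1 < ‖z‖) :
    HasFDerivAt (fun z => z + ∑' n, b n * z⁻¹ ^ n)
      (mulAddConj (1 - (∑' n : ℕ, ((n : ℂ) + 1) * b (n + 1) * z⁻¹ ^ n) * z⁻¹ ^ 2) 0) z := by
  refine ((hasDerivAt_add_powerSeries_inv hb hz).hasFDerivAt.restrictScalars ℝ).congr_fderiv ?_
  refine ContinuousLinearMap.ext fun v => ?_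
  simp [mulAddConj_apply, mul_comm]

/-- The area is the integral of `|p'|²`, where `p'(z) = 1 - ∑ n bₙ z⁻ⁿ⁻¹`. The modes are orthogonal
on circles: the constant contributes `π(R² - 1)` and the others contribute the series. -/
theorem volume_image_annulus {R : ℝ} (hR : 1 < R)
    (hinj : InjOn (fun z => z + ∑' n, b n * z⁻¹ ^ n) {z | 1 < ‖z‖}) :
    volume ((fun z => z + ∑' n, b n * z⁻¹ ^ n) '' annulus 1 R) =
      ENNReal.ofReal (Real.pi * (R ^ 2 - 1)) +
        ∑' n : ℕ, ENNReal.ofReal (Real.pi * (n * ‖b n‖ ^ 2) * (1 - (R⁻¹ ^ n) ^ 2)) := by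
  have hsub : annulus 1 R ⊆ {z | 1 < ‖z‖} := fun z hz => hz.1
  rw [← lintegral_abs_det_fderiv_eq_addHaar_image volume (isOpen_annulus 1 R).measurableSet
    (fun z hz => (hasFDerivAt_add_powerSeries_inv hb (hsub hz)).hasFDerivWithinAt)
    (hinj.mono hsub)]
  set Q : ℂ → ℂ := fun w => ∑' n : ℕ, ((n : ℂ) + 1) * b (n + 1) * w ^ n with hQ
  -- Conjugation preserves the norm and turns powers of `z⁻¹` into modes of nonnegative frequency,
  -- as `lintegral_annulus_norm_sq` requires.
  have hcongr : ∀ z ∈ annulus 1 R, ENNReal.ofReal |(mulAddConj (1 - Q z⁻¹ * z⁻¹ ^ 2) 0).det| =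
      ENNReal.ofReal (‖conj (1 - Q z⁻¹ * z⁻¹ ^ 2)‖ ^ 2) := by
    intro z _
    rw [det_mulAddConj, norm_zero, zero_pow two_ne_zero, sub_zero, abs_of_nonneg (by positivity),
      RCLike.norm_conj]
  rw [setLIntegral_congr_fun (isOpen_annulus 1 R).measurableSet hcongr]
  have hinv : ContinuousOn (fun z : ℂ => z⁻¹) (annulus 1 R) :=
    continuousOn_inv₀.mono fun z hz => norm_pos_iff.mp (one_pos.trans hz.1)
  have hlt : ∀ z ∈ annulus 1 R, ‖z⁻¹‖ < 1 := fun z hz => by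
    rw [norm_inv]
    exact inv_lt_one_of_one_lt₀ hz.1
  have hQc : ContinuousOn (fun z => Q z⁻¹) (annulus 1 R) :=
    (continuousOn_tsum_derivSeries hb).comp hinv fun z hz => mem_ball_zero_iff.mpr (hlt z hz)
  -- Coefficients of the conjugate of `p'`. Here `c 1 = 0`, which excludes the logarithmic exponent
  -- `-1`.
  set c : ℕ → ℂ := fun k => Nat.casesOn k 1 fun n => -(n * conj (b n)) with hc
  have hc0 : c 0 = 1 := rfl
  have hcs : ∀ n, c (n + 1) = -(n * conj (b n)) := fun n => rfl
  rw [lintegral_annulus_norm_sq (h := fun z => conj (1 - Q z⁻¹ * z⁻¹ ^ 2)) zero_le_one hR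
    (Complex.continuous_conj.comp_continuousOn
      (continuousOn_const.sub (hQc.mul (hinv.pow 2)))) c (fun k => -(k : ℤ))]
  · rw [tsum_eq_zero_add' ENNReal.summable]
    congr 1
    · simp [hc0]
    · refine tsum_congr fun n => ?_
      rw [hcs]
      congr 1
      rcases Nat.eq_zero_or_pos n with rfl | hn
      · simp
      have hn' : (n : ℝ) ≠ 0 := by exact_mod_cast hn.ne'
      have hexp : (2 * (-((n + 1 : ℕ) : ℤ)) + 2) = -((n * 2 : ℕ) : ℤ) := by push_cast; ring
      rw [hexp, zpow_neg, zpow_neg, zpow_natCast, zpow_natCast, one_pow, inv_one, norm_neg,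
        norm_mul, Complex.norm_natCast, RCLike.norm_conj, pow_mul, inv_pow, inv_pow]
      have : (((-((n + 1 : ℕ) : ℤ) : ℤ) : ℝ) + 1) = -n := by push_cast; ring
      rw [this]
      field_simp
      ring
  · intro k hk
    have : k = 0 + 1 := by omega
    rw [this, hcs]
    simp
  · intro h
    norm_num at h
  · intro z hz
    rw [← summable_nat_add_iff 2]
    have h1 := (summable_norm_derivSeries hb (norm_nonneg _) (hlt z hz)).mul_right (‖z⁻¹‖ ^ 2)
    refine h1.congr fun n => ?_
    rw [hcs, norm_neg, norm_mul, Complex.norm_natCast, RCLike.norm_conj, zpow_neg, zpow_natCast,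
      norm_inv, mul_assoc, ← pow_add, inv_pow]
    push_cast
    rfl
  · intro z hz
    have hz0 : z ≠ 0 := norm_pos_iff.mp (one_pos.trans hz.1)
    have hterm : ∀ k : ℕ, c k * ((‖z‖ ^ (-(k : ℤ)) : ℝ) : ℂ) * (z / ‖z‖) ^ k =
        c k * conj z⁻¹ ^ k := by
      intro k
      have : conj z⁻¹ = (‖z‖ : ℂ)⁻¹ * (z / ‖z‖) := by
        rw [Complex.inv_def, Complex.normSq_eq_norm_sq]
        simp only [map_mul, Complex.conj_conj, Complex.conj_ofReal]
        push_cast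
        field_simp
      rw [this, mul_pow, zpow_neg, zpow_natCast]
      push_cast
      ring
    simp_rw [hterm]
    have hs : Summable fun k => c k * conj z⁻¹ ^ k := by
      rw [← summable_nat_add_iff 2]
      have h1 := (summable_norm_derivSeries hb (norm_nonneg _) (hlt z hz)).mul_right (‖z⁻¹‖ ^ 2)
      refine Summable.of_norm (h1.congr fun n => ?_)
      rw [hcs, norm_mul, norm_neg, norm_mul, Complex.norm_natCast, RCLike.norm_conj, norm_pow,
        RCLike.norm_conj, mul_assoc, ← pow_add]
      push_cast
      rfl
    rw [hs.tsum_eq_zero_add, ((summable_nat_add_iff 1).mpr hs).tsum_eq_zero_add]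
    simp only [zero_add, hcs, hc0, Nat.cast_zero, zero_mul, neg_zero, pow_zero, mul_one]
    rw [map_sub, map_one, map_mul, map_pow, hQ, sub_eq_add_neg]
    congr 1
    simp only
    rw [Complex.conj_tsum, ← tsum_mul_right, ← tsum_neg]
    refine tsum_congr fun n => ?_
    simp only [map_mul, map_add, map_natCast, map_one, map_pow]
    push_cast
    ring

theorem hasFDerivAt_add_powerSeries_conj {R : ℝ} (hR : 1 < R) {z : ℂ} (hz : ‖z‖ < R) :
    HasFDerivAt (fun z => z + ∑' n, b n * (conj z / (R : ℂ) ^ 2) ^ n)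
      (mulAddConj 1
        ((∑' n : ℕ, ((n : ℂ) + 1) * b (n + 1) * (conj z / (R : ℂ) ^ 2) ^ n) / (R : ℂ) ^ 2)) z := by
  have hR0 : 0 < R := one_pos.trans hR
  have hw : ‖conj z / (R : ℂ) ^ 2‖ < 1 := by
    rw [norm_div, RCLike.norm_conj, norm_pow, Complex.norm_real, Real.norm_of_nonneg hR0.le,
      div_lt_one (by positivity)]
    nlinarith
  have h1 := (hasDerivAt_tsum_powerSeries hb hw).hasFDerivAt.restrictScalars ℝ
  have h2 : HasFDerivAt (fun z : ℂ => conj z / (R : ℂ) ^ 2)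
      (mulAddConj 0 ((R : ℂ) ^ 2)⁻¹) z := by
    convert (mulAddConj 0 ((R : ℂ) ^ 2)⁻¹).hasFDerivAt using 1
    ext z
    rw [mulAddConj_apply, zero_mul, zero_add, div_eq_inv_mul]
  refine (((hasFDerivAt_id z).add (h1.comp z h2)).congr_fderiv ?_ :)
  refine ContinuousLinearMap.ext fun v => ?_
  simp [mulAddConj_apply]
  ring

/-- The Jacobian is `1 - |β|²`, positive by `hsmall`. The integral of `|β|²` is the series, placed
on the left to avoid truncated subtraction. -/
theorem volume_image_punctured_ball {R : ℝ} (hR : 1 < R)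
    (hinj : InjOn (fun z => z + ∑' n, b n * (conj z / (R : ℂ) ^ 2) ^ n) (annulus 0 R))
    (hsmall : ∀ w : ℂ, ‖w‖ ≤ R⁻¹ → ‖∑' n : ℕ, ((n : ℂ) + 1) * b (n + 1) * w ^ n‖ / R ^ 2 < 1) :
    volume ((fun z => z + ∑' n, b n * (conj z / (R : ℂ) ^ 2) ^ n) '' annulus 0 R) +
        ∑' n : ℕ, ENNReal.ofReal (Real.pi * (n * ‖b n‖ ^ 2) * (R⁻¹ ^ n) ^ 2) =
      ENNReal.ofReal (Real.pi * R ^ 2) := by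
  have hR0 : 0 < R := one_pos.trans hR
  have hmeas := (isOpen_annulus 0 R).measurableSet
  rw [← lintegral_abs_det_fderiv_eq_addHaar_image volume hmeas
    (fun z hz => (hasFDerivAt_add_powerSeries_conj hb hR hz.2).hasFDerivWithinAt) hinj]
  set Q : ℂ → ℂ := fun w => ∑' n : ℕ, ((n : ℂ) + 1) * b (n + 1) * w ^ n with hQ
  set β : ℂ → ℂ := fun z => Q (conj z / (R : ℂ) ^ 2) / (R : ℂ) ^ 2 with hβ
  have hnorm : ∀ z : ℂ, ‖conj z / (R : ℂ) ^ 2‖ = ‖z‖ / R ^ 2 := fun z => by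
    rw [norm_div, RCLike.norm_conj, norm_pow, Complex.norm_real, Real.norm_of_nonneg hR0.le]
  have hle : ∀ z ∈ annulus 0 R, ‖z‖ / R ^ 2 ≤ R⁻¹ := fun z hz => by
    rw [div_le_iff₀ (by positivity)]
    calc ‖z‖ ≤ R := hz.2.le
      _ = R⁻¹ * R ^ 2 := by field_simp
  have hlt : ∀ z ∈ annulus 0 R, ‖z‖ / R ^ 2 < 1 := fun z hz =>
    (hle z hz).trans_lt (inv_lt_one_of_one_lt₀ hR)
  have hβ1 : ∀ z ∈ annulus 0 R, ‖β z‖ < 1 := fun z hz => by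
    rw [hβ]
    simp only
    rw [norm_div, norm_pow, Complex.norm_real, Real.norm_of_nonneg hR0.le]
    exact hsmall _ ((hnorm z).trans_le (hle z hz))
  have hβc : ContinuousOn β (annulus 0 R) := by
    refine ContinuousOn.div_const ((continuousOn_tsum_derivSeries hb).comp
      (Continuous.continuousOn (by fun_prop)) fun z hz => ?_) _
    rw [mem_ball_zero_iff, hnorm]
    exact hlt z hz
  have hdet : ∀ z ∈ annulus 0 R, ENNReal.ofReal |(mulAddConj 1 (β z)).det| =
      ENNReal.ofReal (1 - ‖conj (β z)‖ ^ 2) := by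
    intro z hz
    have := hβ1 z hz
    have h0 := norm_nonneg (β z)
    rw [det_mulAddConj, norm_one, one_pow, abs_of_nonneg (by nlinarith), RCLike.norm_conj]
  have hener : ∫⁻ z in annulus 0 R, ENNReal.ofReal (‖conj (β z)‖ ^ 2) =
      ∑' n : ℕ, ENNReal.ofReal (Real.pi * (n * ‖b n‖ ^ 2) * (R⁻¹ ^ n) ^ 2) := by
    set c : ℕ → ℂ := fun n => (n + 1) * conj (b (n + 1)) / (R : ℂ) ^ (2 * (n + 1)) with hc
    have hcn : ∀ n, ‖c n‖ = (n + 1) * ‖b (n + 1)‖ / R ^ (2 * (n + 1)) := fun n => by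
      rw [hc]
      simp only
      rw [norm_div, norm_mul, RCLike.norm_conj, norm_pow, Complex.norm_real,
        Real.norm_of_nonneg hR0.le, ← Nat.cast_succ, Complex.norm_natCast]
      push_cast
      rfl
    rw [lintegral_annulus_norm_sq (h := fun z => conj (β z)) le_rfl hR0
      (Complex.continuous_conj.comp_continuousOn hβc) c (fun k => (k : ℤ))]
    -- Mode `n` of `β` carries `b (n + 1)`; the unmatched term at index `0` has weight zero.
    · rw [tsum_eq_zero_add' (f := fun n : ℕ =>
        ENNReal.ofReal (Real.pi * (n * ‖b n‖ ^ 2) * (R⁻¹ ^ n) ^ 2)) ENNReal.summable]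
      simp only [Nat.cast_zero, zero_mul, mul_zero, ENNReal.ofReal_zero, zero_add]
      refine tsum_congr fun n => ?_
      congr 1
      have hexp : (2 * (n : ℤ) + 2) = ((2 * (n + 1) : ℕ) : ℤ) := by push_cast; ring
      rw [hexp, zpow_natCast, zpow_natCast, zero_pow (by omega), sub_zero, hcn]
      have : (n : ℝ) + 1 ≠ 0 := by positivity
      push_cast
      rw [pow_mul' R 2, inv_pow]
      field_simp
    · intro k hk
      omega
    · intro _ k
      omega
    · intro z hz
      have h1 := (summable_norm_derivSeries hb (by positivity) (hlt z hz)).mul_right ((R ^ 2)⁻¹)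
      refine h1.congr fun n => ?_
      rw [hcn, zpow_natCast, div_pow, pow_mul, pow_succ (R ^ 2)]
      field_simp
    · intro z hz
      have hz0 : (‖z‖ : ℂ) ≠ 0 := Complex.ofReal_ne_zero.mpr hz.1.ne'
      have hRne : (R : ℂ) ≠ 0 := Complex.ofReal_ne_zero.mpr hR0.ne'
      rw [hβ, hQ]
      simp only
      rw [map_div₀, Complex.conj_tsum, map_pow, Complex.conj_ofReal, ← tsum_div_const]
      refine tsum_congr fun n => ?_
      rw [hc]
      simp only [map_mul, map_add, map_natCast, map_one, map_pow, map_div₀, Complex.conj_conj,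
        Complex.conj_ofReal, zpow_natCast]
      push_cast
      rw [pow_mul, pow_succ ((R : ℂ) ^ 2), div_pow, div_pow]
      field_simp
  rw [setLIntegral_congr_fun hmeas hdet, ← hener, ← lintegral_add_right']
  · have hone : ∀ z ∈ annulus 0 R, ENNReal.ofReal (1 - ‖conj (β z)‖ ^ 2) +
        ENNReal.ofReal (‖conj (β z)‖ ^ 2) = 1 := by
      intro z hz
      have := hβ1 z hz
      have h0 := norm_nonneg (β z)
      rw [RCLike.norm_conj, ← ENNReal.ofReal_add (by nlinarith) (by positivity), sub_add_cancel,
        ENNReal.ofReal_one]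
    rw [setLIntegral_congr_fun hmeas hone, setLIntegral_one]
    have hvol : volume (annulus 0 R) = volume (Metric.ball (0 : ℂ) R) := by
      rw [← insert_zero_annulus hR0, measure_congr (insert_ae_eq_self 0 (annulus 0 R))]
    rw [hvol, Complex.volume_ball, mul_comm Real.pi, ENNReal.ofReal_mul (by positivity),
      ENNReal.ofReal_pow hR0.le]
    congr 1
    rw [← NNReal.coe_real_pi, ENNReal.ofReal_coe_nnreal]
  · refine (ENNReal.continuous_ofReal.comp_continuousOn ?_).aemeasurable hmeas
    exact (Complex.continuous_conj.comp_continuousOn hβc).norm.pow 2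

end PowerSeries

end AreaTheorem

/-! ### Gronwall's area theorem. -/

namespace AreaTheorem

open MeasureTheory Set Filter Topology ComplexConjugate

theorem summable_mul_pow_of_forall_inv {b : ℕ → ℂ}
    (hs : ∀ z : ℂ, 1 < ‖z‖ → Summable fun n => b n * z⁻¹ ^ n) (w : ℂ) (hw : ‖w‖ < 1) :
    Summable fun n => b n * w ^ n := by
  by_cases hw0 : w = 0
  · refine summable_of_ne_finset_zero (s := {0}) fun n hn => ?_
    rw [hw0, zero_pow (by simpa using hn), mul_zero]
  · have := hs w⁻¹ (by
      rw [norm_inv]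
      exact one_lt_inv_iff₀.mpr ⟨norm_pos_iff.mpr hw0, hw⟩)
    simpa using this

/-- Gronwall's area theorem, in `ENNReal`-valued form. -/
theorem volume_compl_add_tsum_eq_pi {b : ℕ → ℂ} {g : ℂ → ℂ}
    (hg : ∀ z : ℂ, 1 < ‖z‖ → HasSum (fun n => b n * z⁻¹ ^ n) (g z - z))
    (hinj : InjOn g {z | 1 < ‖z‖}) :
    volume (g '' {z | 1 < ‖z‖})ᶜ + ∑' n : ℕ, ENNReal.ofReal (Real.pi * (n * ‖b n‖ ^ 2)) =
      ENNReal.ofReal Real.pi := by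
  have hb := summable_mul_pow_of_forall_inv fun z hz => (hg z hz).summable
  set p : ℂ → ℂ := fun z => z + ∑' n, b n * z⁻¹ ^ n with hp
  have hgp : EqOn g p {z | 1 < ‖z‖} := fun z hz => by
    rw [hp]
    simp only
    rw [(hg z hz).tsum_eq, add_sub_cancel]
  rw [hgp.image_eq]
  replace hinj : InjOn p {z | 1 < ‖z‖} := hinj.congr hgp
  obtain ⟨R, hR, hbij, hsmall⟩ := exists_radius_bijective hb
  have hR0 : 0 < R := one_pos.trans hR
  set G : ℂ → ℂ := fun z => z + ∑' n, b n * truncInv R z ^ n with hG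
  set q : ℂ → ℂ := fun z => z + ∑' n, b n * (conj z / (R : ℂ) ^ 2) ^ n with hq
  have hGp : ∀ z, R ≤ ‖z‖ → G z = p z := fun z hz => by
    simp only [hG, hp, truncInv_of_ge hz]
  have hGq : EqOn q G (annulus 0 R) := fun z hz => by
    simp only [hG, hq, truncInv_of_le hz.2.le]
  have hann := volume_image_annulus hb hR hinj
  have hball := volume_image_punctured_ball hb hR (hbij.injective.injOn.congr hGq.symm) hsmall
  rw [hGq.image_eq] at hball
  have hAm : MeasurableSet (p '' annulus 1 R) :=
    measurable_image_of_fderivWithin (isOpen_annulus 1 R).measurableSet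
      (fun z hz => (hasFDerivAt_add_powerSeries_inv hb hz.1).hasFDerivWithinAt)
      (hinj.mono fun z hz => hz.1)
  -- A `G`-preimage of `p z` with norm at least `R` would also be a `p`-preimage, hence equal to `z`
  -- by univalence, contradicting `‖z‖ < R`.
  have hsub : p '' annulus 1 R ⊆ G '' Metric.ball 0 R := by
    rintro _ ⟨z, hz, rfl⟩
    obtain ⟨w, hw⟩ := hbij.surjective (p z)
    refine ⟨w, mem_ball_zero_iff.mpr ?_, hw⟩
    by_contra hwR
    rw [not_lt] at hwR
    rw [hGp w hwR] at hw
    have : w = z := hinj (show 1 < ‖w‖ from hR.trans_le hwR) (show 1 < ‖z‖ from hz.1) hw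
    exact absurd hz.2 (not_lt.mpr (this ▸ hwR))
  -- Bijectivity of `G` makes `G '' ball` the complement of `p '' {R ≤ ‖z‖}`; removing the image of
  -- the annulus leaves exactly the omitted set.
  have hcompl : (p '' {z | 1 < ‖z‖})ᶜ = G '' Metric.ball 0 R \ p '' annulus 1 R := by
    ext y
    constructor
    · intro hy
      refine ⟨?_, fun ⟨z, hz, h⟩ => hy ⟨z, hz.1, h⟩⟩
      obtain ⟨w, hw⟩ := hbij.surjective y
      refine ⟨w, mem_ball_zero_iff.mpr ?_, hw⟩
      by_contra hwR
      rw [not_lt] at hwR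
      exact hy ⟨w, show 1 < ‖w‖ from hR.trans_le hwR, by rw [← hGp w hwR, hw]⟩
    · rintro ⟨⟨w, hw, rfl⟩, hy⟩ ⟨z, hz, h⟩
      rw [mem_ball_zero_iff] at hw
      rcases lt_or_ge ‖z‖ R with hzR | hzR
      · exact hy ⟨z, ⟨hz, hzR⟩, h⟩
      · rw [← hGp z hzR] at h
        have := hbij.injective h
        exact absurd hw (not_lt.mpr (this ▸ hzR))
  -- The centre contributes a single point, which is null.
  have hvolG : volume (G '' Metric.ball 0 R) = volume (G '' annulus 0 R) := by
    rw [← insert_zero_annulus hR0, image_insert_eq, measure_congr (insert_ae_eq_self _ _)]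
  have hsplit := measure_inter_add_sdiff (μ := volume) (G '' Metric.ball 0 R) hAm
  rw [inter_eq_right.mpr hsub, ← hcompl, hvolG] at hsplit
  rw [← hsplit, hann] at hball
  have hadd : ∀ n : ℕ, ENNReal.ofReal (Real.pi * (n * ‖b n‖ ^ 2) * (1 - (R⁻¹ ^ n) ^ 2)) +
      ENNReal.ofReal (Real.pi * (n * ‖b n‖ ^ 2) * (R⁻¹ ^ n) ^ 2) =
      ENNReal.ofReal (Real.pi * (n * ‖b n‖ ^ 2)) := by
    intro n
    have h1 : (R⁻¹ ^ n) ^ 2 ≤ 1 :=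
      pow_le_one₀ (by positivity) (pow_le_one₀ (by positivity) (inv_le_one_of_one_le₀ hR.le))
    have h2 : 0 ≤ 1 - (R⁻¹ ^ n) ^ 2 := sub_nonneg.mpr h1
    rw [← ENNReal.ofReal_add (by positivity) (by positivity)]
    congr 1
    ring
  have htot : ENNReal.ofReal (Real.pi * R ^ 2) =
      ENNReal.ofReal (Real.pi * (R ^ 2 - 1)) + ENNReal.ofReal Real.pi := by
    have : 0 ≤ R ^ 2 - 1 := by nlinarith
    rw [← ENNReal.ofReal_add (by positivity) (by positivity)]
    congr 1
    ring
  rw [htot] at hball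
  simp_rw [← hadd]
  rw [ENNReal.tsum_add]
  -- Cancelling `π(R² - 1)` is legitimate because it is finite.
  refine (ENNReal.add_right_inj
    (ENNReal.ofReal_ne_top (r := Real.pi * (R ^ 2 - 1)))).mp (Eq.trans ?_ hball)
  ring

/-- Gronwall's area theorem. -/
theorem area_theorem {b : ℕ → ℂ} {g : ℂ → ℂ}
    (hg : ∀ z : ℂ, 1 < ‖z‖ → HasSum (fun n => b n * z⁻¹ ^ n) (g z - z))
    (hinj : InjOn g {z | 1 < ‖z‖}) :
    Summable (fun n : ℕ => (n : ℝ) * ‖b n‖ ^ 2) ∧ ∑' n : ℕ, (n : ℝ) * ‖b n‖ ^ 2 ≤ 1 ∧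
      volume (g '' {z | 1 < ‖z‖})ᶜ =
        ENNReal.ofReal (Real.pi * (1 - ∑' n : ℕ, (n : ℝ) * ‖b n‖ ^ 2)) := by
  have h := volume_compl_add_tsum_eq_pi hg hinj
  have hs' : Summable fun n : ℕ => Real.pi * (n * ‖b n‖ ^ 2) := by
    have hne : ∑' n : ℕ, ENNReal.ofReal (Real.pi * (n * ‖b n‖ ^ 2)) ≠ ⊤ :=
      ne_top_of_le_ne_top (h ▸ ENNReal.ofReal_ne_top) le_add_self
    refine (ENNReal.summable_toReal hne).congr fun n => ?_
    rw [ENNReal.toReal_ofReal (by positivity)]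
  have hs : Summable fun n : ℕ => (n : ℝ) * ‖b n‖ ^ 2 :=
    (summable_mul_left_iff Real.pi_ne_zero).mp hs'
  rw [← ENNReal.ofReal_tsum_of_nonneg (fun n => by positivity) hs', tsum_mul_left] at h
  set S : ℝ := ∑' n : ℕ, (n : ℝ) * ‖b n‖ ^ 2
  have hS0 : 0 ≤ S := tsum_nonneg fun n => by positivity
  have hS1 : S ≤ 1 := by
    have h1 : ENNReal.ofReal (Real.pi * S) ≤ ENNReal.ofReal Real.pi := h ▸ le_add_self
    rw [ENNReal.ofReal_le_ofReal_iff Real.pi_pos.le] at h1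
    nlinarith [Real.pi_pos]
  refine ⟨hs, hS1, ?_⟩
  rw [mul_sub, mul_one, ENNReal.ofReal_sub _ (by positivity), ← h,
    ENNReal.add_sub_cancel_right ENNReal.ofReal_ne_top]

end AreaTheorem

/-! ### Splitting the quaternions as `ℂ_I ⊕ ℂ_I J`. -/

namespace SliceRegular

open Set

theorem inner_eq_components (p q : ℍ[ℝ]) :
    inner ℝ p q = p.re * q.re + p.imI * q.imI + p.imJ * q.imJ + p.imK * q.imK := by
  rw [Quaternion.inner_def]
  simp

theorem sq_add_sq_add_sq_of_mem_imagUnits {I : ℍ[ℝ]} (hI : I ∈ imagUnits) :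
    I.imI ^ 2 + I.imJ ^ 2 + I.imK ^ 2 = 1 := by
  have h := real_inner_self_eq_norm_sq I
  rw [inner_eq_components, hI.1, hI.2] at h
  linarith

theorem mul_self_of_mem_imagUnits {I : ℍ[ℝ]} (hI : I ∈ imagUnits) : I * I = -1 := by
  have h := sq_add_sq_add_sq_of_mem_imagUnits hI
  ext <;> simp [hI.1] <;> linarith

theorem star_of_mem_imagUnits {I : ℍ[ℝ]} (hI : I ∈ imagUnits) : star I = -I := by
  ext <;> simp [hI.1]

theorem anticommute_of_inner_eq_zero {I J : ℍ[ℝ]} (hI : I ∈ imagUnits) (hJ : J ∈ imagUnits)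
    (hIJ : inner ℝ I J = 0) : J * I = -(I * J) := by
  rw [inner_eq_components, hI.1] at hIJ
  ext <;> simp [hI.1, hJ.1] <;> linarith

@[simp]
theorem re_planeMap (I : ℍ[ℝ]) (z : ℂ) : (planeMap I z).re = z.re + I.re * z.im := by
  simp [planeMap]

@[simp]
theorem imI_planeMap (I : ℍ[ℝ]) (z : ℂ) : (planeMap I z).imI = I.imI * z.im := by
  simp [planeMap]

@[simp]
theorem imJ_planeMap (I : ℍ[ℝ]) (z : ℂ) : (planeMap I z).imJ = I.imJ * z.im := by
  simp [planeMap]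

@[simp]
theorem imK_planeMap (I : ℍ[ℝ]) (z : ℂ) : (planeMap I z).imK = I.imK * z.im := by
  simp [planeMap]

theorem planeMap_mul {I : ℍ[ℝ]} (hI : I ∈ imagUnits) (z w : ℂ) :
    planeMap I (z * w) = planeMap I z * planeMap I w := by
  have h := sq_add_sq_add_sq_of_mem_imagUnits hI
  ext
  · simp [hI.1]
    linear_combination (z.im * w.im) * h
  all_goals
    simp [hI.1]
    ring

theorem planeMap_one (I : ℍ[ℝ]) : planeMap I 1 = 1 := by simp [planeMap]

theorem planeMap_add (I : ℍ[ℝ]) (z w : ℂ) :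
    planeMap I (z + w) = planeMap I z + planeMap I w := by
  ext <;> simp <;> ring

theorem norm_planeMap {I : ℍ[ℝ]} (hI : I ∈ imagUnits) (z : ℂ) : ‖planeMap I z‖ = ‖z‖ := by
  have h := sq_add_sq_add_sq_of_mem_imagUnits hI
  refine (sq_eq_sq₀ (norm_nonneg _) (norm_nonneg _)).mp ?_
  rw [← real_inner_self_eq_norm_sq, inner_eq_components, ← Complex.normSq_eq_norm_sq,
    Complex.normSq_apply]
  simp only [re_planeMap, imI_planeMap, imJ_planeMap, imK_planeMap, hI.1]
  linear_combination z.im ^ 2 * h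

/-- The real-linear projection of the quaternions onto `ℂ_I`, in complex coordinates. -/
noncomputable def planeProj (I : ℍ[ℝ]) : ℍ[ℝ] →L[ℝ] ℂ :=
  LinearMap.toContinuousLinearMap
    { toFun := fun q => ⟨inner ℝ 1 q, inner ℝ I q⟩
      map_add' := fun p q => by
        apply Complex.ext <;> simp [inner_add_right]
      map_smul' := fun r q => by
        apply Complex.ext <;> simp [inner_smul_right] }

theorem planeProj_apply (I q : ℍ[ℝ]) : planeProj I q = ⟨inner ℝ 1 q, inner ℝ I q⟩ := rfl

theorem planeProj_planeMap {I : ℍ[ℝ]} (hI : I ∈ imagUnits) (z : ℂ) :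
    planeProj I (planeMap I z) = z := by
  have h := sq_add_sq_add_sq_of_mem_imagUnits hI
  rw [planeProj_apply, inner_eq_components, inner_eq_components]
  apply Complex.ext
  · simp [hI.1]
  · simp only [re_planeMap, imI_planeMap, imJ_planeMap, imK_planeMap, hI.1]
    linear_combination z.im * h

theorem planeMap_injective {I : ℍ[ℝ]} (hI : I ∈ imagUnits) : Function.Injective (planeMap I) :=
  Function.LeftInverse.injective (planeProj_planeMap hI)

theorem planeMap_inv {I : ℍ[ℝ]} (hI : I ∈ imagUnits) {z : ℂ} (hz : z ≠ 0) :
    planeMap I z⁻¹ = (planeMap I z)⁻¹ := by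
  refine eq_inv_of_mul_eq_one_left ?_
  rw [← planeMap_mul hI, inv_mul_cancel₀ hz, planeMap_one]

theorem planeMap_pow {I : ℍ[ℝ]} (hI : I ∈ imagUnits) (z : ℂ) (n : ℕ) :
    planeMap I (z ^ n) = planeMap I z ^ n := by
  induction n with
  | zero => simp [planeMap_one]
  | succ n ih => rw [pow_succ, pow_succ, planeMap_mul hI, ih]

theorem planeMap_planeProj {I : ℍ[ℝ]} (hI : I ∈ imagUnits) (q : ℍ[ℝ]) :
    planeMap I (planeProj I q) = fstPart I q := by
  have h := sq_add_sq_add_sq_of_mem_imagUnits hI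
  rw [planeProj_apply, inner_eq_components, inner_eq_components, fstPart]
  ext
  · simp [hI.1]
    linear_combination (-(1 / 2) * q.re) * h
  · simp [hI.1]
    linear_combination (1 / 2 * q.imI) * h
  · simp [hI.1]
    linear_combination (1 / 2 * q.imJ) * h
  · simp [hI.1]
    linear_combination (1 / 2 * q.imK) * h

/-- Elements of `ℂ_I` commute with `I`. This linearity over `ℂ_I` turns the series with left powers
`q⁻ⁿ` into a complex series. -/
theorem fstPart_planeMap_mul (I : ℍ[ℝ]) (z : ℂ) (q : ℍ[ℝ]) :
    fstPart I (planeMap I z * q) = planeMap I z * fstPart I q := by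
  have hc : I * planeMap I z = planeMap I z * I := by
    rw [planeMap, mul_add, add_mul, ← mul_assoc, mul_assoc I, Quaternion.coe_commutes,
      ← mul_assoc, mul_assoc I _ I, Quaternion.coe_commutes, mul_assoc]
  rw [fstPart, fstPart, mul_smul_comm, mul_sub, ← mul_assoc, hc]
  simp only [mul_assoc]

theorem planeProj_planeMap_mul {I : ℍ[ℝ]} (hI : I ∈ imagUnits) (z : ℂ) (q : ℍ[ℝ]) :
    planeProj I (planeMap I z * q) = z * planeProj I q := by
  apply planeMap_injective hI
  rw [planeMap_planeProj hI, fstPart_planeMap_mul, planeMap_mul hI, planeMap_planeProj hI]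

/-- Moving `star J` past `I` flips the sign, so the second component needs no separate theory. -/
theorem sndPart_eq_fstPart {I J : ℍ[ℝ]} (hI : I ∈ imagUnits) (hJ : J ∈ imagUnits)
    (hIJ : inner ℝ I J = 0) (q : ℍ[ℝ]) : sndPart I J q = fstPart I (q * star J) := by
  have hanti := anticommute_of_inner_eq_zero hI hJ hIJ
  rw [sndPart, fstPart, smul_mul_assoc, add_mul, sub_eq_add_neg, star_of_mem_imagUnits hJ]
  congr 2
  simp only [mul_assoc, mul_neg, neg_mul, neg_neg, hanti]

/-- Parallelogram law for `q` and `I q I`, which have equal norms. -/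
theorem norm_sq_eq_fstPart_add_sndPart {I J : ℍ[ℝ]} (hI : I ∈ imagUnits) (hJ : J ∈ imagUnits)
    (q : ℍ[ℝ]) : ‖q‖ ^ 2 = ‖fstPart I q‖ ^ 2 + ‖sndPart I J q‖ ^ 2 := by
  have hp := parallelogram_law_with_norm ℝ q (I * q * I)
  have hn : ‖I * q * I‖ = ‖q‖ := by rw [norm_mul, norm_mul, hI.2, one_mul, mul_one]
  rw [hn] at hp
  rw [fstPart, sndPart, norm_mul, norm_star, hJ.2, mul_one, norm_smul, norm_smul]
  norm_num
  linarith

theorem mem_sliceExterior_iff {I : ℍ[ℝ]} (hI : I ∈ imagUnits) (q : ℍ[ℝ]) :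
    q ∈ sliceExterior I ↔ ∃ z : ℂ, 1 < ‖z‖ ∧ planeMap I z = q := by
  constructor
  · rintro ⟨hq, z, rfl⟩
    exact ⟨z, by rw [← norm_planeMap hI]; exact hq, rfl⟩
  · rintro ⟨z, hz, rfl⟩
    exact ⟨show 1 < ‖planeMap I z‖ by rwa [norm_planeMap hI], z, rfl⟩

theorem planeArea_diff_image {I : ℍ[ℝ]} (hI : I ∈ imagUnits) {F : ℍ[ℝ] → ℍ[ℝ]} {g : ℂ → ℂ}
    (hFg : ∀ z : ℂ, 1 < ‖z‖ → F (planeMap I z) = planeMap I (g z)) :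
    planeArea I (plane I \ F '' sliceExterior I) =
      MeasureTheory.volume (g '' {z | 1 < ‖z‖})ᶜ := by
  rw [planeArea]
  congr 1
  ext w
  simp only [mem_preimage, mem_sdiff, mem_compl_iff]
  constructor
  · rintro ⟨_, h⟩ ⟨z, hz, rfl⟩
    exact h ⟨planeMap I z, (mem_sliceExterior_iff hI _).mpr ⟨z, hz, rfl⟩, hFg z hz⟩
  · intro h
    refine ⟨⟨w, rfl⟩, ?_⟩
    rintro ⟨q, hq, hqw⟩
    obtain ⟨z, hz, rfl⟩ := (mem_sliceExterior_iff hI q).mp hq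
    rw [hFg z hz] at hqw
    exact h ⟨z, hz, planeMap_injective hI hqw⟩

theorem fstPart_planeMap {I : ℍ[ℝ]} (hI : I ∈ imagUnits) (z : ℂ) :
    fstPart I (planeMap I z) = planeMap I z := by
  rw [← planeMap_planeProj hI, planeProj_planeMap hI]

theorem fstPart_planeMap_mul_orthogonal {I J : ℍ[ℝ]} (hI : I ∈ imagUnits) (hJ : J ∈ imagUnits)
    (hIJ : inner ℝ I J = 0) (z : ℂ) : fstPart I (planeMap I z * J) = 0 := by
  rw [fstPart_planeMap_mul, fstPart, mul_assoc, anticommute_of_inner_eq_zero hI hJ hIJ, mul_neg,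
    ← mul_assoc, mul_self_of_mem_imagUnits hI]
  simp

theorem fstPart_add (I p q : ℍ[ℝ]) : fstPart I (p + q) = fstPart I p + fstPart I q := by
  rw [fstPart, fstPart, fstPart, ← smul_add]
  congr 1
  noncomm_ring

theorem fstPart_split {I J : ℍ[ℝ]} (hI : I ∈ imagUnits) (hJ : J ∈ imagUnits)
    (hIJ : inner ℝ I J = 0) (z w : ℂ) :
    fstPart I (planeMap I z + planeMap I w * J) = planeMap I z := by
  rw [fstPart_add, fstPart_planeMap hI, fstPart_planeMap_mul_orthogonal hI hJ hIJ, add_zero]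

theorem sndPart_split {I J : ℍ[ℝ]} (hI : I ∈ imagUnits) (hJ : J ∈ imagUnits)
    (hIJ : inner ℝ I J = 0) (z w : ℂ) :
    sndPart I J (planeMap I z + planeMap I w * J) = planeMap I w := by
  have h1 : J * star J = 1 := by
    rw [star_of_mem_imagUnits hJ, mul_neg, mul_self_of_mem_imagUnits hJ, neg_neg]
  rw [sndPart_eq_fstPart hI hJ hIJ, add_mul, mul_assoc, h1, mul_one, fstPart_add,
    fstPart_planeMap hI, star_of_mem_imagUnits hJ, mul_neg, ← neg_mul]
  have : -planeMap I z = planeMap I (-z) := by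
    ext <;> simp [add_comm]
  rw [this, fstPart_planeMap_mul_orthogonal hI hJ hIJ, zero_add]

theorem norm_planeProj {I : ℍ[ℝ]} (hI : I ∈ imagUnits) (q : ℍ[ℝ]) :
    ‖planeProj I q‖ = ‖fstPart I q‖ := by
  rw [← planeMap_planeProj hI, norm_planeMap hI]

end SliceRegular

/-! ### The area theorem for slice regular functions. -/

open SliceRegular in
theorem mainTheorem1
    (f : ℍ[ℝ] → ℍ[ℝ]) (a : ℕ → ℍ[ℝ])
    (hf : SliceRegular.IsSliceRegularOn f SliceRegular.exterior)
    (hseries : ∀ q ∈ SliceRegular.exterior,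
      HasSum (fun n : ℕ => (q⁻¹) ^ n * a n) (f q - q))
    (I J : ℍ[ℝ]) (hI : I ∈ SliceRegular.imagUnits) (hJ : J ∈ SliceRegular.imagUnits)
    (hIJ : inner ℝ I J = 0)
    (f₁ f₂ : ℍ[ℝ] → ℍ[ℝ])
    (hf₁ : Set.MapsTo f₁ (SliceRegular.sliceExterior I) (SliceRegular.plane I))
    (hf₂ : Set.MapsTo f₂ (SliceRegular.sliceExterior I) (SliceRegular.plane I))
    (hsplit : ∀ z ∈ SliceRegular.sliceExterior I, f z = f₁ z + f₂ z * J)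
    (huniv₁ : Set.InjOn f₁ (SliceRegular.sliceExterior I))
    (huniv₂ : Set.InjOn (fun z => z + f₂ z) (SliceRegular.sliceExterior I)) :
    Summable (fun n : ℕ => (n : ℝ) * ‖a n‖ ^ 2) ∧
    SliceRegular.planeArea I (SliceRegular.plane I \
        ((fun z => SliceRegular.fstPart I (f z)) '' SliceRegular.sliceExterior I)) +
      SliceRegular.planeArea I (SliceRegular.plane I \
        ((fun z => z + SliceRegular.sndPart I J (f z)) '' SliceRegular.sliceExterior I)) =
      ENNReal.ofReal (Real.pi * (2 - ∑' n : ℕ, (n : ℝ) * ‖a n‖ ^ 2)) ∧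
    ∑' n : ℕ, (n : ℝ) * ‖a n‖ ^ 2 ≤ 2 ∧
    ‖a 1‖ ≤ Real.sqrt 2 ∧
    (‖a 1‖ = Real.sqrt 2 ↔
      (∀ q ∈ SliceRegular.exterior, f q = q + a 0 + q⁻¹ * a 1) ∧
        ‖SliceRegular.fstPart I (a 1)‖ = 1 ∧ ‖SliceRegular.sndPart I J (a 1)‖ = 1) := by
  have hmem : ∀ z : ℂ, 1 < ‖z‖ → planeMap I z ∈ sliceExterior I := fun z hz =>
    (mem_sliceExterior_iff hI _).mpr ⟨z, hz, rfl⟩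
  -- `g` and `h` are `f₁` and `z + f₂` in complex coordinates.
  set g : ℂ → ℂ := fun z => planeProj I (f (planeMap I z)) with hg
  set h : ℂ → ℂ := fun z => z + planeProj I (f (planeMap I z) * star J) with hh
  have hgf : ∀ z : ℂ, 1 < ‖z‖ → fstPart I (f (planeMap I z)) = planeMap I (g z) := fun z _ =>
    (planeMap_planeProj hI _).symm
  have hhf : ∀ z : ℂ, 1 < ‖z‖ →
      planeMap I z + sndPart I J (f (planeMap I z)) = planeMap I (h z) := fun z _ => by
    rw [hh, planeMap_add, planeMap_planeProj hI, sndPart_eq_fstPart hI hJ hIJ]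
  have hf₁g : ∀ z : ℂ, 1 < ‖z‖ → f₁ (planeMap I z) = planeMap I (g z) := fun z hz => by
    obtain ⟨u, hu⟩ := hf₁ (hmem z hz)
    obtain ⟨v, hv⟩ := hf₂ (hmem z hz)
    rw [← hgf z hz, hsplit _ (hmem z hz), ← hu, ← hv, fstPart_split hI hJ hIJ]
  have hf₂h : ∀ z : ℂ, 1 < ‖z‖ → planeMap I z + f₂ (planeMap I z) = planeMap I (h z) :=
      fun z hz => by
    obtain ⟨u, hu⟩ := hf₁ (hmem z hz)
    obtain ⟨v, hv⟩ := hf₂ (hmem z hz)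
    rw [← hhf z hz, hsplit _ (hmem z hz), ← hu, ← hv, sndPart_split hI hJ hIJ]
  have hginj : Set.InjOn g {z | 1 < ‖z‖} := fun z hz w hw hzw =>
    planeMap_injective hI (huniv₁ (hmem z hz) (hmem w hw) (by
      rw [hf₁g z hz, hf₁g w hw, hzw]))
  have hhinj : Set.InjOn h {z | 1 < ‖z‖} := fun z hz w hw hzw =>
    planeMap_injective hI (huniv₂ (hmem z hz) (hmem w hw) (by
      simp only
      rw [hf₂h z hz, hf₂h w hw, hzw]))
  have hpow : ∀ z : ℂ, 1 < ‖z‖ → ∀ n : ℕ, (planeMap I z)⁻¹ ^ n = planeMap I (z⁻¹ ^ n) :=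
    fun z hz n => by
      rw [planeMap_pow hI, planeMap_inv hI (norm_pos_iff.mp (one_pos.trans hz))]
  have hgs : ∀ z : ℂ, 1 < ‖z‖ →
      HasSum (fun n => planeProj I (a n) * z⁻¹ ^ n) (g z - z) := fun z hz => by
    have h1 := (hseries _ (hmem z hz).1).mapL (planeProj I)
    rw [map_sub, planeProj_planeMap hI] at h1
    simpa only [hpow z hz, planeProj_planeMap_mul hI, mul_comm (z⁻¹ ^ _)] using h1
  have hhs : ∀ z : ℂ, 1 < ‖z‖ →
      HasSum (fun n => planeProj I (a n * star J) * z⁻¹ ^ n) (h z - z) := fun z hz => by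
    have h1 := ((hseries _ (hmem z hz).1).mul_right (star J)).mapL (planeProj I)
    -- The leading term `q` has no `J`-component; the summand `z` in `h` restores the normalisation
    -- needed by Gronwall's theorem.
    have h0 : planeProj I (planeMap I z * star J) = 0 := by
      apply planeMap_injective hI
      rw [planeMap_planeProj hI, ← sndPart_eq_fstPart hI hJ hIJ]
      simpa [planeMap] using sndPart_split hI hJ hIJ z 0
    rw [sub_mul, map_sub, h0, sub_zero] at h1
    rw [hh, add_sub_cancel_left]
    simpa only [hpow z hz, mul_assoc, planeProj_planeMap_mul hI, mul_comm (z⁻¹ ^ _)] using h1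
  obtain ⟨hsum₁, hle₁, hvol₁⟩ := AreaTheorem.area_theorem hgs hginj
  obtain ⟨hsum₂, hle₂, hvol₂⟩ := AreaTheorem.area_theorem hhs hhinj
  have hfst : ∀ n, ‖planeProj I (a n)‖ = ‖fstPart I (a n)‖ := fun n => norm_planeProj hI _
  have hsnd : ∀ n, ‖planeProj I (a n * star J)‖ = ‖sndPart I J (a n)‖ := fun n => by
    rw [norm_planeProj hI, sndPart_eq_fstPart hI hJ hIJ]
  simp only [hfst] at hsum₁ hle₁ hvol₁
  simp only [hsnd] at hsum₂ hle₂ hvol₂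
  have hnorm : ∀ n : ℕ, (n : ℝ) * ‖a n‖ ^ 2 =
      n * ‖fstPart I (a n)‖ ^ 2 + n * ‖sndPart I J (a n)‖ ^ 2 := fun n => by
    rw [norm_sq_eq_fstPart_add_sndPart hI hJ, mul_add]
  have hsum : Summable fun n : ℕ => (n : ℝ) * ‖a n‖ ^ 2 :=
    (hsum₁.add hsum₂).congr fun n => (hnorm n).symm
  have htsum : ∑' n : ℕ, (n : ℝ) * ‖a n‖ ^ 2 =
      ∑' n : ℕ, (n : ℝ) * ‖fstPart I (a n)‖ ^ 2 + ∑' n : ℕ, (n : ℝ) * ‖sndPart I J (a n)‖ ^ 2 := by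
    rw [← hsum₁.tsum_add hsum₂]
    exact tsum_congr hnorm
  have hle : ∑' n : ℕ, (n : ℝ) * ‖a n‖ ^ 2 ≤ 2 := by linarith
  have hone : ∀ {c : ℕ → ℝ} {C : ℝ}, Summable (fun n : ℕ => (n : ℝ) * c n ^ 2) →
      ∑' n : ℕ, (n : ℝ) * c n ^ 2 ≤ C → c 1 ^ 2 ≤ C := fun {c C} hc hC => by
    have := hc.le_tsum 1 fun n _ => by positivity
    rw [Nat.cast_one, one_mul] at this
    exact this.trans hC
  refine ⟨hsum, ?_, hle, ?_, ?_, ?_⟩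
  · rw [planeArea_diff_image hI hgf, planeArea_diff_image hI hhf, hvol₁, hvol₂,
      ← ENNReal.ofReal_add (mul_nonneg Real.pi_pos.le (sub_nonneg.mpr hle₁))
        (mul_nonneg Real.pi_pos.le (sub_nonneg.mpr hle₂)), htsum]
    congr 1
    ring
  · exact Real.le_sqrt_of_sq_le (hone hsum hle)
  · intro heq
    have hsq : ‖a 1‖ ^ 2 = 2 := by rw [heq, Real.sq_sqrt zero_le_two]
    -- The term at `1` already exhausts the bound `2`. The coefficient `a 0` has weight zero and
    -- stays free.
    have hzero : ∀ n, n ≠ 0 → n ≠ 1 → a n = 0 := by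
      intro n hn0 hn1
      have h1 := hsum.sum_le_tsum {1, n} fun n _ => by positivity
      rw [Finset.sum_pair hn1.symm, Nat.cast_one, one_mul, hsq] at h1
      have h2 : (n : ℝ) * ‖a n‖ ^ 2 ≤ 0 := by linarith
      have h3 : (0 : ℝ) < n := by exact_mod_cast Nat.pos_of_ne_zero hn0
      have h4 : ‖a n‖ ^ 2 ≤ 0 := nonpos_of_mul_nonpos_right h2 h3
      exact norm_eq_zero.mp (pow_eq_zero_iff two_ne_zero |>.mp (le_antisymm h4 (sq_nonneg _)))
    have h1 := hone hsum₁ hle₁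
    have h2 := hone hsum₂ hle₂
    have h3 := norm_sq_eq_fstPart_add_sndPart hI hJ (a 1)
    refine ⟨fun q hq => ?_, ?_, ?_⟩
    · have hs : HasSum (fun n : ℕ => q⁻¹ ^ n * a n) (∑ n ∈ {0, 1}, q⁻¹ ^ n * a n) :=
        hasSum_sum_of_ne_finset_zero fun n hn => by
          simp only [Finset.mem_insert, Finset.mem_singleton, not_or] at hn
          rw [hzero n hn.1 hn.2, mul_zero]
      have := (hseries q hq).unique hs
      rw [Finset.sum_pair zero_ne_one, pow_zero, one_mul, pow_one] at this
      rw [add_assoc, ← this, add_sub_cancel]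
    -- The squared component norms are each at most `1` and sum to `2`, so both equal `1`.
    · exact (pow_eq_one_iff_of_nonneg (norm_nonneg _) two_ne_zero).mp (by linarith)
    · exact (pow_eq_one_iff_of_nonneg (norm_nonneg _) two_ne_zero).mp (by linarith)
  · rintro ⟨_, h1, h2⟩
    rw [← Real.sqrt_sq (norm_nonneg (a 1)), norm_sq_eq_fstPart_add_sndPart hI hJ, h1, h2]
    norm_num
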